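/- Let $(R,\mathfrak m)$ be a reduced Noetherian local ring of prime characteristic $p>0$ and Krull dimension $d$, and suppose that $R$ is $F$-finite, i.e. $R^{1/p}$ is a finitely generated $R$-module via the inclusion $R\subseteq R^{1/p}$ (equivalently, the Frobenius endomorphism of $R$ is finite). For $q=p^e$ and an ideal $\mathfrak a$ of $R$, let $\mathfrak a^{[q]}$ be the ideal generated by the $q$-th powers of all elements of $\mathfrak a$, let $\lambda_R$ denote length, and for $\mathfrak m$-primary $\mathfrak a$ let $$e_{\rm HK}(\mathfrak a)=\lim_{e\to\infty}\frac{\lambda_R(R/\mathfrak a^{[p^e]})}{p^{ed}},\qquad e_{\rm HK}(R)=e_{\rm HK}(\mathfrak m).$$ Then for every $\mathfrak m$-primary ideal $I$, the limits defining $e_{\rm HK}(I)$ and $e_{\rm HK}(R)$ exist as real numbers, and $$e_{\rm HK}(I)\le e_{\rm HK}(R)\cdot\lambda_R(R/I).$$ -/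

import Mathlib

open Filter Topology

noncomputable section

/-- The bracket power `I^[q]`: the ideal generated by the `q`th powers of all elements of `I`
(used below for `q = p ^ e`). -/
def bracketPower {R : Type*} [CommRing R] (I : Ideal R) (q : ℕ) : Ideal R :=
  Ideal.span ((fun a : R => a ^ q) '' (I : Set R))

/-- `I` is `𝔪`-primary, where `𝔪` is the maximal ideal of the local ring `R`. -/
def IsMPrimary {R : Type*} [CommRing R] [IsLocalRing R] (I : Ideal R) : Prop :=
  I.IsPrimary ∧ I.radical = IsLocalRing.maximalIdeal R

/-- A ring of prime characteristic `p` is `F`-finite if the Frobenius `x ↦ x ^ p` makes `R` a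
finite module over itself. For reduced `R`, extraction of `p`-th roots identifies this module with
`R^{1/p}`, viewed as an `R`-module via the inclusion `R ⊆ R^{1/p}`. -/
def IsFFinite (R : Type*) [CommRing R] (p : ℕ) [Fact p.Prime] [CharP R p] : Prop :=
  (frobenius R p).Finite

/-- The colength `λ_R(R/I)`, as a natural number. It is a genuine value whenever `R/I` has finite
length, in particular for all `𝔪`-primary ideals of a Noetherian local ring and all
their bracket powers, see `IsMPrimary.length_ne_top` and `IsMPrimary.bracketPower`. -/
def colength {R : Type*} [CommRing R] (I : Ideal R) : ℕ :=
  (Module.length R (R ⧸ I)).toNat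

/-- The Krull dimension as a natural number; Noetherian local rings have finite dimension `≥ 0`,
so that nothing is lost for them, see `coe_krullDimNat`. -/
def krullDimNat (R : Type*) [CommRing R] : ℕ :=
  ((ringKrullDim R).unbotD 0).toNat

/-- The sequence `e ↦ λ_R(R/I^[q]) / q^d`, with `q = p ^ e` and `d = dim R`. -/
def hilbertKunzSeq {R : Type*} [CommRing R] (p : ℕ) (I : Ideal R) (e : ℕ) : ℝ :=
  (colength (bracketPower I (p ^ e)) : ℝ) / ((p ^ e : ℕ) : ℝ) ^ krullDimNat R

/-- The Hilbert-Kunz multiplicity `e_HK(I) = lim_{q → ∞} λ_R(R/I^[q]) / q^d`. -/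
def hilbertKunzMultiplicity {R : Type*} [CommRing R] (p : ℕ) (I : Ideal R) : ℝ :=
  limUnder atTop (hilbertKunzSeq p I)

/-- The Hilbert-Kunz multiplicity of a local ring: `e_HK(R) = e_HK(𝔪)`. -/
def ringHilbertKunzMultiplicity (R : Type*) [CommRing R] [IsLocalRing R] (p : ℕ) : ℝ :=
  hilbertKunzMultiplicity p (IsLocalRing.maximalIdeal R)

theorem coe_krullDimNat (R : Type*) [CommRing R] [IsLocalRing R] [IsNoetherianRing R] :
    ((krullDimNat R : ℕ) : WithBot ℕ∞) = ringKrullDim R := by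
  obtain ⟨n, hn⟩ : ∃ n : ℕ∞, ringKrullDim R = n :=
    ⟨_, (WithBot.coe_unbot _ ringKrullDim_ne_bot).symm⟩
  have ht : n ≠ ⊤ := by
    rintro rfl
    exact ringKrullDim_ne_top (R := R) hn
  lift n to ℕ using ht
  simp [krullDimNat, hn]

theorem IsMPrimary.bracketPower {R : Type*} [CommRing R] [IsLocalRing R] {I : Ideal R}
    (hI : IsMPrimary I) {q : ℕ} (hq : q ≠ 0) : IsMPrimary (bracketPower I q) := by
  have hr : (_root_.bracketPower I q).radical = IsLocalRing.maximalIdeal R := by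
    refine le_antisymm ?_ ?_
    · rw [← hI.2]
      refine Ideal.radical_mono (Ideal.span_le.2 ?_)
      rintro _ ⟨a, ha, rfl⟩
      exact I.pow_mem_of_mem ha q (Nat.pos_of_ne_zero hq)
    · rw [← hI.2]
      rw [Ideal.radical_le_radical_iff]
      exact fun a ha => ⟨q, Ideal.subset_span ⟨a, ha, rfl⟩⟩
  refine ⟨Ideal.isPrimary_of_isMaximal_radical ?_, hr⟩
  rw [hr]; infer_instance

theorem IsMPrimary.length_ne_top {R : Type*} [CommRing R] [IsLocalRing R] [IsNoetherianRing R]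
    {I : Ideal R} (hI : IsMPrimary I) : Module.length R (R ⧸ I) ≠ ⊤ := by
  have : Ring.KrullDimLE 0 (R ⧸ I) := by
    refine Ring.krullDimLE_zero_iff.2 fun P hP => ?_
    have h1 : I ≤ P.comap (Ideal.Quotient.mk I) := by
      intro x hx
      rw [Ideal.mem_comap, Ideal.Quotient.eq_zero_iff_mem.2 hx]
      exact P.zero_mem
    have h2 : IsLocalRing.maximalIdeal R ≤ P.comap (Ideal.Quotient.mk I) := by
      rw [← hI.2]
      exact (Ideal.IsPrime.radical_le_iff inferInstance).2 h1
    have h3 : (P.comap (Ideal.Quotient.mk I)).IsMaximal := by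
      rw [← (IsLocalRing.maximalIdeal.isMaximal R).eq_of_le Ideal.IsPrime.ne_top' h2]
      infer_instance
    have h4 := Ideal.map_eq_top_or_isMaximal_of_surjective (Ideal.Quotient.mk I)
      Ideal.Quotient.mk_surjective h3
    rw [Ideal.map_comap_of_surjective _ Ideal.Quotient.mk_surjective] at h4
    exact h4.resolve_left hP.ne_top
  have : IsArtinianRing (R ⧸ I) :=
    isArtinianRing_iff_isNoetherianRing_krullDimLE_zero.2 ⟨inferInstance, this⟩
  have : IsArtinian R (R ⧸ I) :=
    (isArtinian_of_surjective_algebraMap (R := R ⧸ I) (S := R) (M := R ⧸ I)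
      Ideal.Quotient.mk_surjective)
  exact Module.length_ne_top

end

/-! The inequality already holds before the limit. If I ≠ R, some x has I : x = 𝔪, and then 𝔪^[q] ⊆
I^[q] : x^q. So passing from I to I + (x) lowers λ(R/I) by one and λ(R/I^[q]) by at most λ(R/𝔪^[q]);
induct on λ(R/I) (`quotLength_bracketPower_le_mul`).

Existence of the limits is the main work. For a domain, R viewed as a module over itself through
Frobenius agrees with a free module R^r up to cokernels killed by some u ≠ 0. Tensoring with R/I^[q]
gives |α λ(R/I^[pq]) − r λ(R/I^[q])| ≤ n λ(R/(I^[q] + u)) = O(q^(d-1)), where α is the residue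
degree of Frobenius (`exists_quotLength_map_compare`). The normalized lengths t_e thus satisfy |a
t_(e+1) − b t_e| ≤ C/p^e. The equality a = b is not computed from ranks: t_e lies between two
positive constants, which forces it, and then t_e is Cauchy (`exists_tendsto_of_recursion`). The
upper constant comes from a system of parameters, the lower one from λ(R/𝔪^n) ≥ c n^d.

A reduced R agrees with the product of its R/P, P minimal, up to cokernels killed by a
nonzerodivisor, so the domain case suffices. -/

noncomputable section

/-- The length of `R / J` as an extended natural number. -/
def quotLength {R : Type*} [CommRing R] (J : Ideal R) : ℕ∞ := Module.length R (R ⧸ J)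

/-! ### Colengths and colon ideals -/

section quotLength

variable {R : Type*} [CommRing R]

theorem quotLength_anti {J K : Ideal R} (h : J ≤ K) : quotLength K ≤ quotLength J :=
  Module.length_le_of_surjective (Submodule.factor h) (Submodule.factor_surjective h)

@[simp]
theorem quotLength_top : quotLength (⊤ : Ideal R) = 0 := by
  have : Subsingleton (R ⧸ (⊤ : Ideal R)) := Ideal.Quotient.subsingleton_iff.2 rfl
  exact Module.length_eq_zero

/-- Multiplication by x gives the exact sequence 0 → R/(J : x) → R/J → R/(J + (x)) → 0. -/
theorem quotLength_eq_colon_add_sup (J : Ideal R) (x : R) :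
    quotLength J = quotLength (J.colon {x}) + quotLength (J ⊔ Ideal.span {x}) := by
  let f : (R ⧸ J.colon {x}) →ₗ[R] (R ⧸ J) :=
    Submodule.mapQ _ _ (LinearMap.mulLeft R x) fun r hr => by
      simpa [mul_comm] using Submodule.mem_colon_singleton.1 hr
  refine Module.length_eq_add_of_exact f (Submodule.factor le_sup_left) ?_
    (Submodule.factor_surjective le_sup_left) ?_
  · rw [injective_iff_map_eq_zero]
    intro a
    induction a using Submodule.Quotient.induction_on with | _ r
    intro h
    have h' : x * r ∈ J := (Submodule.Quotient.mk_eq_zero J).1 h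
    rw [Submodule.Quotient.mk_eq_zero, Submodule.mem_colon_singleton]
    simpa [mul_comm] using h'
  · intro a
    induction a using Submodule.Quotient.induction_on with | _ r
    constructor
    · intro h
      have h' : r ∈ J ⊔ Ideal.span {x} :=
        (Submodule.Quotient.mk_eq_zero _).1 h
      obtain ⟨j, hj, y, hy, rfl⟩ := Submodule.mem_sup.1 h'
      obtain ⟨s, rfl⟩ := Ideal.mem_span_singleton'.1 hy
      refine ⟨Submodule.Quotient.mk s, ?_⟩
      simp only [f, Submodule.mapQ_apply, LinearMap.mulLeft_apply]
      rw [Submodule.Quotient.eq]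
      have : x * s - (j + s * x) = -j := by ring
      rw [this]
      exact J.neg_mem hj
    · rintro ⟨b, hb⟩
      induction b using Submodule.Quotient.induction_on with | _ s
      rw [← hb]
      simp only [f, Submodule.mapQ_apply, LinearMap.mulLeft_apply]
      rw [Submodule.Quotient.mk_eq_zero]
      exact Ideal.mem_sup_right (Ideal.mul_mem_right _ _ (Ideal.mem_span_singleton_self x))

/-- Each extra power of x costs at most one copy of R/(J + (x)), because (J + (x^(n+1))) : x^n
contains J + (x). -/
theorem quotLength_sup_span_pow_le (J : Ideal R) (x : R) (n : ℕ) :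
    quotLength (J ⊔ Ideal.span {x ^ n}) ≤ n * quotLength (J ⊔ Ideal.span {x}) := by
  induction n with
  | zero => simp [Ideal.span_singleton_one]
  | succ n ih =>
    rw [quotLength_eq_colon_add_sup _ (x ^ n), Nat.cast_add, add_mul, Nat.cast_one, one_mul,
      add_comm]
    refine add_le_add ?_ ?_
    · refine (quotLength_anti ?_).trans ih
      exact sup_le_sup_right le_sup_left _
    · refine quotLength_anti (sup_le ?_ ?_)
      · exact fun a ha => Submodule.mem_colon_singleton.2
          (Ideal.mul_mem_right _ _ (Ideal.mem_sup_left ha))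
      · rw [Ideal.span_singleton_le_iff_mem, Submodule.mem_colon_singleton, smul_eq_mul,
          ← pow_succ']
        exact Ideal.mem_sup_right (Ideal.mem_span_singleton_self _)

/-- Exponents are raised one generator at a time; J varies in the induction in order to absorb the
generators already treated. -/
theorem quotLength_sup_span_image_pow_le (s : Finset R) (n : ℕ) (J : Ideal R) :
    quotLength (J ⊔ Ideal.span ((fun x => x ^ n) '' (s : Set R))) ≤
      (n : ℕ∞) ^ s.card * quotLength (J ⊔ Ideal.span (s : Set R)) := by
  classical
  induction s using Finset.induction_on generalizing J with
  | empty => simp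
  | insert x s hx ih =>
    rw [Finset.coe_insert, Set.image_insert_eq, Finset.card_insert_of_notMem hx,
      Ideal.span_insert, Ideal.span_insert, ← sup_assoc, ← sup_assoc]
    refine (ih _).trans ?_
    rw [pow_succ, mul_assoc]
    gcongr
    rw [sup_right_comm J (Ideal.span {x ^ n}), sup_right_comm J (Ideal.span {x})]
    exact quotLength_sup_span_pow_le _ _ _

theorem quotLength_map_mk (I J : Ideal R) :
    quotLength (J.map (Ideal.Quotient.mk I)) = quotLength (J ⊔ I) := by
  unfold quotLength
  rw [← Module.length_eq_of_surjective (S := R) Ideal.Quotient.mk_surjective]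
  let f : R →ₗ[R] ((R ⧸ I) ⧸ J.map (Ideal.Quotient.mk I)) :=
    Algebra.linearMap R ((R ⧸ I) ⧸ J.map (Ideal.Quotient.mk I))
  have hs : Function.Surjective f :=
    Ideal.Quotient.mk_surjective.comp (Ideal.Quotient.mk_surjective (I := I))
  have hk : LinearMap.ker f = J ⊔ I := by
    have : LinearMap.ker f = Ideal.comap (Ideal.Quotient.mk I)
        (RingHom.ker (Ideal.Quotient.mk (J.map (Ideal.Quotient.mk I)))) := rfl
    rw [this, Ideal.mk_ker, Ideal.comap_map_of_surjective' _ Ideal.Quotient.mk_surjective,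
      Ideal.mk_ker]
  exact ((Submodule.quotEquivOfEq _ _ hk).symm ≪≫ₗ
    f.quotKerEquivOfSurjective hs).length_eq.symm

end quotLength

/-! ### Lengths after tensoring with R/J -/

section length

variable {R M N : Type*} [CommRing R] [AddCommGroup M] [AddCommGroup N] [Module R M] [Module R N]

open TensorProduct

/-- Injectivity of f is not assumed, since tensoring preserves only right exactness. -/
theorem Module.length_le_add_of_exact {P : Type*} [AddCommGroup P] [Module R P] (f : M →ₗ[R] N)
    (g : N →ₗ[R] P) (hg : Function.Surjective g) (h : Function.Exact f g) :
    Module.length R N ≤ Module.length R M + Module.length R P := by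
  rw [Module.length_eq_add_of_exact (LinearMap.ker g).subtype g (Submodule.subtype_injective _) hg
    (LinearMap.exact_subtype_ker_map g)]
  gcongr
  rw [h.linearMap_ker_eq]
  exact Module.length_le_of_surjective f.rangeRestrict f.surjective_rangeRestrict

/-- If `u` kills the module `T` and `T` is generated by `n` elements, then `T / J T` is a quotient
of `n` copies of `R / (J + u R)`. -/
theorem Module.length_tensor_le_of_smul_eq_zero {n : ℕ} (f : (Fin n → R) →ₗ[R] M)
    (hf : Function.Surjective f) (u : R) (hu : ∀ m : M, u • m = 0) (J : Ideal R) :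
    Module.length R ((R ⧸ J) ⊗[R] M) ≤ n * quotLength (J ⊔ Ideal.span {u}) := by
  have : (n : ℕ∞) * quotLength (J ⊔ Ideal.span {u}) =
      Module.length R (Fin n → (R ⧸ (J ⊔ Ideal.span {u}))) := by
    simp [quotLength]
  rw [this, (TensorProduct.quotTensorEquivQuotSMul M J).length_eq]
  have hk (i : Fin n) : (J ⊔ Ideal.span {u}) ≤
      LinearMap.ker ((Submodule.mkQ (J • ⊤ : Submodule R M)).comp
        (f.comp (LinearMap.single R (fun _ => R) i))) := by
    refine sup_le ?_ ?_
    · intro r hr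
      have : (Pi.single i r : Fin n → R) = r • Pi.single i 1 := by
        rw [← Pi.single_smul]; simp
      simp only [LinearMap.mem_ker, LinearMap.comp_apply, LinearMap.single_apply, this, map_smul]
      rw [← map_smul, Submodule.mkQ_apply, Submodule.Quotient.mk_eq_zero]
      exact Submodule.smul_mem_smul hr trivial
    · rw [Ideal.span_singleton_le_iff_mem]
      have : (Pi.single i u : Fin n → R) = u • Pi.single i 1 := by
        rw [← Pi.single_smul]; simp
      simp only [LinearMap.mem_ker, LinearMap.comp_apply, LinearMap.single_apply, this, map_smul]
      rw [← map_smul, hu, map_zero]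
  refine Module.length_le_of_surjective
    (LinearMap.lsum R (fun _ => R ⧸ (J ⊔ Ideal.span {u})) ℕ fun i => Submodule.liftQ _ _ (hk i)) ?_
  intro y
  obtain ⟨m, rfl⟩ := Submodule.mkQ_surjective _ y
  obtain ⟨a, rfl⟩ := hf m
  refine ⟨fun i => Submodule.Quotient.mk (a i), ?_⟩
  simp only [LinearMap.lsum_apply, LinearMap.coe_sum, LinearMap.coe_comp, Finset.sum_apply,
    Function.comp_apply, LinearMap.proj_apply, Submodule.liftQ_apply, LinearMap.single_apply]
  rw [← map_sum, ← map_sum]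
  simp [Finset.univ_sum_single]

/-- If the cokernel of `f : M → N` is killed by `u`, then `N / J N` is at most as long
as `M / J M` up to a multiple of the length of `R / (J + u R)`. -/
theorem Module.exists_length_tensor_le [Module.Finite R N] (f : M →ₗ[R] N) (u : R)
    (hu : ∀ y : N, u • y ∈ LinearMap.range f) :
    ∃ n : ℕ, ∀ J : Ideal R, Module.length R ((R ⧸ J) ⊗[R] N) ≤
      Module.length R ((R ⧸ J) ⊗[R] M) + n * quotLength (J ⊔ Ideal.span {u}) := by
  -- The constant counts generators of the cokernel, hence does not depend on J.
  obtain ⟨n, g, hg⟩ := Module.Finite.exists_fin' R (N ⧸ LinearMap.range f)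
  refine ⟨n, fun J => ?_⟩
  have hex : Function.Exact f (LinearMap.range f).mkQ := LinearMap.exact_map_mkQ_range f
  refine (Module.length_le_add_of_exact _ _
    (LinearMap.lTensor_surjective (R ⧸ J) (Submodule.mkQ_surjective _))
    (lTensor_exact (R ⧸ J) hex (Submodule.mkQ_surjective _))).trans ?_
  gcongr
  refine Module.length_tensor_le_of_smul_eq_zero g hg u (fun m => ?_) J
  obtain ⟨y, rfl⟩ := Submodule.mkQ_surjective _ m
  rw [← map_smul, Submodule.mkQ_apply, Submodule.Quotient.mk_eq_zero]
  exact hu y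

theorem Module.length_quotient_tensor_self (J : Ideal R) :
    Module.length R ((R ⧸ J) ⊗[R] R) = quotLength J :=
  (TensorProduct.rid R (R ⧸ J)).length_eq

theorem Module.length_quotient_tensor_pi {ι : Type*} [Finite ι] (M : ι → Type*)
    [∀ i, AddCommGroup (M i)] [∀ i, Module R (M i)] [Fintype ι] (J : Ideal R) :
    Module.length R ((R ⧸ J) ⊗[R] (∀ i, M i)) = ∑ i, Module.length R ((R ⧸ J) ⊗[R] M i) := by
  classical
  rw [(TensorProduct.piRight R R (R ⧸ J) M).length_eq, Module.length_pi_of_fintype]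

theorem Module.length_quotient_tensor_algebra {S : Type*} [CommRing S] [Algebra R S]
    (J : Ideal R) :
    Module.length R ((R ⧸ J) ⊗[R] S) = Module.length R (S ⧸ J.map (algebraMap R S)) := by
  rw [(TensorProduct.quotTensorEquivQuotSMul S J).length_eq, Ideal.smul_top_eq_map]
  rfl

theorem Module.length_quotient_tensor_quotient (I J : Ideal R) :
    Module.length R ((R ⧸ J) ⊗[R] (R ⧸ I)) = quotLength (J ⊔ I) := by
  rw [Module.length_quotient_tensor_algebra, ← quotLength_map_mk,
    Module.length_eq_of_surjective (R := R ⧸ I) Ideal.Quotient.mk_surjective]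
  rfl

end length

open IsLocalRing

/-! ### 𝔪-primary ideals -/

section IsMPrimary

variable {R : Type*} [CommRing R] [IsLocalRing R]

theorem IsMPrimary.of_pow_le {I : Ideal R} {n : ℕ} (h : maximalIdeal R ^ n ≤ I)
    (hI : I ≤ maximalIdeal R) : IsMPrimary I := by
  have hr : I.radical = maximalIdeal R := by
    refine le_antisymm ((Ideal.IsPrime.radical_le_iff inferInstance).2 hI) fun x hx => ?_
    exact ⟨n, h (Ideal.pow_mem_pow hx n)⟩
  refine ⟨Ideal.isPrimary_of_isMaximal_radical ?_, hr⟩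
  rw [hr]
  infer_instance

theorem IsMPrimary.le_maximalIdeal {I : Ideal R} (hI : IsMPrimary I) : I ≤ maximalIdeal R :=
  hI.2 ▸ Ideal.le_radical

theorem IsMPrimary.exists_pow_le [IsNoetherianRing R] {I : Ideal R} (hI : IsMPrimary I) :
    ∃ n, maximalIdeal R ^ n ≤ I := by
  rw [← hI.2]
  exact Ideal.exists_radical_pow_le_of_fg I (IsNoetherian.noetherian _)

theorem isMPrimary_maximalIdeal : IsMPrimary (maximalIdeal R) :=
  .of_pow_le (n := 1) (by simp) le_rfl

theorem IsMPrimary.map_of_surjective [IsNoetherianRing R] {S : Type*} [CommRing S] [IsLocalRing S]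
    {I : Ideal R} (hI : IsMPrimary I) (f : R →+* S) (hf : Function.Surjective f) :
    IsMPrimary (I.map f) := by
  obtain ⟨n, hn⟩ := hI.exists_pow_le
  refine .of_pow_le (n := n) ?_ ?_
  · rw [← map_maximalIdeal_of_surjective f hf, ← Ideal.map_pow]
    exact Ideal.map_mono hn
  · rw [← map_maximalIdeal_of_surjective f hf]
    exact Ideal.map_mono hI.le_maximalIdeal

theorem quotLength_ne_top_of_pow_le [IsNoetherianRing R] {I : Ideal R} {n : ℕ}
    (h : maximalIdeal R ^ n ≤ I) : quotLength I ≠ ⊤ := by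
  by_cases hI : I = ⊤
  · simp [hI]
  · exact (IsMPrimary.of_pow_le h (IsLocalRing.le_maximalIdeal hI)).length_ne_top

theorem IsMPrimary.quotLength_sup_ne_top [IsNoetherianRing R] {I : Ideal R} (hI : IsMPrimary I)
    (J : Ideal R) : quotLength (I ⊔ J) ≠ ⊤ := by
  obtain ⟨n, hn⟩ := hI.exists_pow_le
  exact quotLength_ne_top_of_pow_le (hn.trans le_sup_left)

end IsMPrimary

/-! ### Bracket powers as extensions along Frobenius -/

section bracketPower

variable {R : Type*} [CommRing R]

theorem pow_mem_bracketPower {I : Ideal R} {x : R} (hx : x ∈ I) (q : ℕ) :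
    x ^ q ∈ bracketPower I q :=
  Ideal.subset_span ⟨x, hx, rfl⟩

theorem bracketPower_le_pow (I : Ideal R) (q : ℕ) : bracketPower I q ≤ I ^ q := by
  refine Ideal.span_le.2 ?_
  rintro _ ⟨a, ha, rfl⟩
  exact Ideal.pow_mem_pow ha q

variable (p : ℕ) [ExpChar R p]

theorem bracketPower_eq_map_iterateFrobenius (I : Ideal R) (e : ℕ) :
    bracketPower I (p ^ e) = I.map (iterateFrobenius R p e) := rfl

theorem bracketPower_succ (I : Ideal R) (e : ℕ) :
    bracketPower I (p ^ (e + 1)) = (bracketPower I (p ^ e)).map (frobenius R p) := by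
  rw [bracketPower_eq_map_iterateFrobenius, bracketPower_eq_map_iterateFrobenius, Ideal.map_map,
    iterateFrobenius_eq_pow, iterateFrobenius_eq_pow, pow_succ']
  rfl

theorem bracketPower_map {S : Type*} [CommRing S] [ExpChar S p] (f : R →+* S) (I : Ideal R)
    (e : ℕ) : bracketPower (I.map f) (p ^ e) = (bracketPower I (p ^ e)).map f := by
  simp only [bracketPower_eq_map_iterateFrobenius, Ideal.map_map, RingHom.iterateFrobenius_comm]

theorem bracketPower_sup_span_singleton (I : Ideal R) (x : R) (e : ℕ) :
    bracketPower (I ⊔ Ideal.span {x}) (p ^ e) =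
      bracketPower I (p ^ e) ⊔ Ideal.span {x ^ p ^ e} := by
  simp only [bracketPower_eq_map_iterateFrobenius, Ideal.map_sup, Ideal.map_span,
    Set.image_singleton, iterateFrobenius_def]

end bracketPower

/-! ### Upper bounds from systems of parameters -/

section upperBound

variable {R : Type*} [CommRing R] [IsLocalRing R] [IsNoetherianRing R]

/-- Existence of a system of parameters of `R / 𝔞`, lifted to `R`. -/
theorem exists_finset_quotLength_sup_span_ne_top (𝔞 : Ideal R) (k : ℕ)
    (hk : ringKrullDim (R ⧸ 𝔞) ≤ k) (h𝔞 : 𝔞 ≠ ⊤) :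
    ∃ s : Finset R, s.card ≤ k ∧ (s : Set R) ⊆ maximalIdeal R ∧
      quotLength (𝔞 ⊔ Ideal.span (s : Set R)) ≠ ⊤ := by
  classical
  have : Nontrivial (R ⧸ 𝔞) := Ideal.Quotient.nontrivial_iff.2 h𝔞
  have : IsLocalRing (R ⧸ 𝔞) :=
    .of_surjective' (Ideal.Quotient.mk 𝔞) Ideal.Quotient.mk_surjective
  -- Converse of Krull's height theorem: the maximal ideal is minimal over an ideal generated by as
  -- many elements as its height, so the quotient is Artinian.
  obtain ⟨s, hs, hcard⟩ :=
    (maximalIdeal (R ⧸ 𝔞)).exists_finset_card_eq_height_of_isNoetherianRing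
  have hart := IsLocalRing.quotient_artinian_of_mem_minimalPrimes_of_isLocalRing _ hs
  obtain ⟨n, hn⟩ := exists_maximalIdeal_pow_le_of_isArtinianRing_quotient
    (Ideal.span (s : Set (R ⧸ 𝔞)))
  obtain ⟨t, ht, hts⟩ : ∃ t : Finset R, t.card ≤ s.card ∧
      (Ideal.Quotient.mk 𝔞) '' (t : Set R) = (s : Set (R ⧸ 𝔞)) := by
    refine ⟨s.image (Function.surjInv Ideal.Quotient.mk_surjective), Finset.card_image_le, ?_⟩
    ext y
    simp [Function.surjInv_eq]
  have hmap := map_maximalIdeal_of_surjective _ (Ideal.Quotient.mk_surjective (I := 𝔞))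
  refine ⟨t, ht.trans ?_, fun x hx => ?_, ?_⟩
  · have : ((s.card : ℕ∞) : WithBot ℕ∞) ≤ ((k : ℕ∞) : WithBot ℕ∞) := by
      rw [hcard, maximalIdeal_height_eq_ringKrullDim]
      exact hk
    exact_mod_cast this
  · by_contra hxm
    have hu : IsUnit x := by simpa using hxm
    have h1 : Ideal.Quotient.mk 𝔞 x ∈ maximalIdeal (R ⧸ 𝔞) :=
      hs.1.2 (Ideal.subset_span (hts ▸ Set.mem_image_of_mem _ hx))
    exact (mem_maximalIdeal _).1 h1 (hu.map _)
  · rw [sup_comm, ← quotLength_map_mk, Ideal.map_span, hts]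
    exact quotLength_ne_top_of_pow_le hn

/-- If 𝔪^n ⊆ I and x is one of the parameters of R/𝔞, then x^(nq) = (x^n)^q lies in I^[q]. So the
length is at most (nq)^|s| times a constant, with |s| ≤ k. -/
theorem IsMPrimary.exists_quotLength_bracketPower_sup_le {I : Ideal R} (hI : IsMPrimary I)
    (𝔞 : Ideal R) (k : ℕ) (hk : ringKrullDim (R ⧸ 𝔞) ≤ k) :
    ∃ C : ℕ, ∀ q : ℕ, q ≠ 0 → quotLength (_root_.bracketPower I q ⊔ 𝔞) ≤ C * (q : ℕ∞) ^ k := by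
  by_cases h𝔞 : 𝔞 = ⊤
  · exact ⟨0, fun q _ => by simp [h𝔞]⟩
  obtain ⟨s, hcard, hsm, hs⟩ := exists_finset_quotLength_sup_span_ne_top 𝔞 k hk h𝔞
  obtain ⟨n, hn⟩ := hI.exists_pow_le
  lift quotLength (𝔞 ⊔ Ideal.span (s : Set R)) to ℕ using hs with l hl
  refine ⟨n ^ s.card * l, fun q hq => ?_⟩
  have h1 : 𝔞 ⊔ Ideal.span ((fun x => x ^ (n * q)) '' (s : Set R)) ≤ _root_.bracketPower I q ⊔ 𝔞 := by
    rw [sup_comm]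
    refine sup_le_sup_right (Ideal.span_le.2 ?_) _
    rintro _ ⟨x, hx, rfl⟩
    dsimp only
    rw [pow_mul]
    exact pow_mem_bracketPower (hn (Ideal.pow_mem_pow (hsm hx) n)) q
  refine (quotLength_anti h1).trans ((quotLength_sup_span_image_pow_le s _ 𝔞).trans ?_)
  rw [← hl]
  norm_cast
  rw [mul_pow, mul_right_comm]
  gcongr
  omega

theorem IsMPrimary.exists_quotLength_bracketPower_le {I : Ideal R} (hI : IsMPrimary I) :
    ∃ C : ℕ, ∀ q : ℕ, q ≠ 0 →
      quotLength (_root_.bracketPower I q) ≤ C * (q : ℕ∞) ^ krullDimNat R := by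
  obtain ⟨C, hC⟩ := hI.exists_quotLength_bracketPower_sup_le ⊥ (krullDimNat R) (by
    rw [ringKrullDim_eq_of_ringEquiv (RingEquiv.quotientBot R), ← coe_krullDimNat])
  exact ⟨C, fun q hq => by simpa using hC q hq⟩

/-- A nonunit nonzerodivisor lowers the dimension by at least one, which saves a factor q. Keeping
that factor on the left avoids the exponent d − 1 when d = 0. -/
theorem IsMPrimary.exists_mul_quotLength_bracketPower_sup_le {I : Ideal R} (hI : IsMPrimary I)
    {u : R} (hu : u ∈ nonZeroDivisors R) :
    ∃ C : ℕ, ∀ q : ℕ, q ≠ 0 →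
      q * quotLength (_root_.bracketPower I q ⊔ Ideal.span {u}) ≤ C * (q : ℕ∞) ^ krullDimNat R := by
  by_cases htop : Ideal.span {u} = ⊤
  · exact ⟨0, fun q _ => by simp [htop]⟩
  have hdim := ringKrullDim_quotient_succ_le_of_nonZeroDivisor hu
  have : Nontrivial (R ⧸ Ideal.span {u}) := Ideal.Quotient.nontrivial_iff.2 htop
  have : IsLocalRing (R ⧸ Ideal.span {u}) :=
    .of_surjective' (Ideal.Quotient.mk _) Ideal.Quotient.mk_surjective
  rw [← coe_krullDimNat, ← coe_krullDimNat] at hdim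
  obtain ⟨C, hC⟩ := hI.exists_quotLength_bracketPower_sup_le (Ideal.span {u})
    (krullDimNat (R ⧸ Ideal.span {u})) (coe_krullDimNat _).ge
  refine ⟨C, fun q hq => ?_⟩
  have hdim' : krullDimNat (R ⧸ Ideal.span {u}) + 1 ≤ krullDimNat R := by exact_mod_cast hdim
  calc (q : ℕ∞) * quotLength (_root_.bracketPower I q ⊔ Ideal.span {u})
      ≤ q * (C * (q : ℕ∞) ^ krullDimNat (R ⧸ Ideal.span {u})) := by gcongr; exact hC q hq
    _ = C * (q : ℕ∞) ^ (krullDimNat (R ⧸ Ideal.span {u}) + 1) := by ring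
    _ ≤ _ := by
      norm_cast
      gcongr
      omega

end upperBound

/-! ### Generic freeness and finite local maps -/

open IsLocalRing

/-- Over a domain, a finite module `M` and a free module `A ^ r` map to
each other with cokernels killed by a nonzero element. -/
theorem exists_linearMap_pi_of_isDomain (A M : Type*) [CommRing A] [IsDomain A] [AddCommGroup M]
    [Module A M] [Module.Finite A M] :
    ∃ (r : ℕ) (f : (Fin r → A) →ₗ[A] M) (g : M →ₗ[A] (Fin r → A)) (t : A), t ≠ 0 ∧
      (∀ y, t • y ∈ LinearMap.range f) ∧ ∀ y : Fin r → A, t • y ∈ LinearMap.range g := by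
  classical
  -- A linearly independent family of maximal size spans a free submodule with torsion quotient.
  obtain ⟨b, hb⟩ := exists_linearIndependent_of_le_rank (R := A) (M := M)
    (n := Module.finrank A M) (by rw [Module.finrank_eq_rank])
  let f : (Fin (Module.finrank A M) → A) →ₗ[A] M := Fintype.linearCombination A b
  have hf : Function.Injective f := LinearIndependent.fintypeLinearCombination_injective hb
  have htor : Module.IsTorsion A (M ⧸ LinearMap.range f) := by
    rw [← Module.finrank_eq_zero_iff_isTorsion]
    have h1 := Submodule.finrank_quotient_add_finrank (R := A) (LinearMap.range f)
    have h2 : Module.finrank A (LinearMap.range f) = Module.finrank A M := by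
      rw [LinearMap.finrank_range_of_inj hf]
      simp
    omega
  obtain ⟨t, ht0, ht⟩ : ∃ t : A, t ≠ 0 ∧ ∀ y : M ⧸ LinearMap.range f, t • y = 0 := by
    obtain ⟨s, hs⟩ := Module.Finite.fg_top (R := A) (M := M ⧸ LinearMap.range f)
    choose a ha using fun y => htor (x := y)
    -- One nonzero annihilator per generator; their product kills the whole quotient.
    refine ⟨∏ y ∈ s, (a y : A), ?_, fun y => ?_⟩
    · exact Finset.prod_ne_zero_iff.2 fun y _ => nonZeroDivisors.coe_ne_zero _
    · have hy : y ∈ Submodule.span A (s : Set (M ⧸ LinearMap.range f)) := hs ▸ trivial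
      induction hy using Submodule.span_induction with
      | mem y hy =>
        rw [← Finset.prod_erase_mul _ _ hy, mul_smul]
        have := ha y
        rw [Submonoid.smul_def] at this
        rw [this, smul_zero]
      | zero => simp
      | add x y _ _ hx hy => rw [smul_add, hx, hy, add_zero]
      | smul c x _ hx => rw [smul_comm, hx, smul_zero]
  have ht' (y : M) : t • y ∈ LinearMap.range f := by
    have := ht (Submodule.Quotient.mk y)
    rwa [← Submodule.Quotient.mk_smul, Submodule.Quotient.mk_eq_zero] at this
  -- Multiplication by t lands in the range of f, where f can be inverted; hence g ∘ f = t.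
  let g : M →ₗ[A] (Fin (Module.finrank A M) → A) :=
    (LinearEquiv.ofInjective f hf).symm.toLinearMap.comp
      ((LinearMap.lsmul A M t).codRestrict (LinearMap.range f) ht')
  refine ⟨_, f, g, t, ht0, ht', fun y => ⟨f y, ?_⟩⟩
  apply (LinearEquiv.ofInjective f hf).injective
  ext
  simp [g]
  rfl

/-- For a finite local homomorphism `φ : A → B` from a Noetherian local domain, the lengths of
`B / J B` and `A / J` are proportional up to the length of `A / (J + u A)` for some `u ≠ 0`. -/
theorem exists_quotLength_map_compare {A B : Type*} [CommRing A] [IsDomain A] [IsLocalRing A]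
    [IsNoetherianRing A] [CommRing B] [IsLocalRing B] (φ : A →+* B) (hφ : φ.Finite)
    [IsLocalHom φ] :
    ∃ (r α n : ℕ) (u : A), α ≠ 0 ∧ u ≠ 0 ∧ ∀ J : Ideal A,
      α * quotLength (J.map φ) ≤ r * quotLength J + n * quotLength (J ⊔ Ideal.span {u}) ∧
      r * quotLength J ≤ α * quotLength (J.map φ) + n * quotLength (J ⊔ Ideal.span {u}) := by
  algebraize [φ]
  have : IsLocalHom (algebraMap A B) := ‹IsLocalHom φ›
  obtain ⟨r, f, g, u, hu, hf, hg⟩ := exists_linearMap_pi_of_isDomain A B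
  obtain ⟨n₁, hn₁⟩ := Module.exists_length_tensor_le f u hf
  obtain ⟨n₂, hn₂⟩ := Module.exists_length_tensor_le g u hg
  have hfree (J : Ideal A) : Module.length A (TensorProduct A (A ⧸ J) (Fin r → A)) =
      r * quotLength J := by
    rw [Module.length_quotient_tensor_pi]
    simp [Module.length_quotient_tensor_self]
  -- The residue degree converts length over B into length over A.
  have hB (J : Ideal A) : Module.length A (TensorProduct A (A ⧸ J) B) =
      Module.finrank (ResidueField A) (ResidueField B) * quotLength (J.map φ) := by
    rw [Module.length_quotient_tensor_algebra, IsLocalRing.length_restrictScalars A B,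
      Module.length_eq_finrank, mul_comm]
    rfl
  refine ⟨r, Module.finrank (ResidueField A) (ResidueField B), max n₁ n₂, u,
    Module.finrank_pos.ne', hu, fun J => ⟨?_, ?_⟩⟩
  · rw [← hB, ← hfree]
    refine (hn₁ J).trans ?_
    gcongr
    exact le_max_left _ _
  · rw [← hB, ← hfree]
    refine (hn₂ J).trans ?_
    gcongr
    exact le_max_right _ _

/-! ### Lower bound for λ(R/𝔪^n) -/

section lowerBound

open IsLocalRing

theorem pow_succ_sub_pow_succ_le {m k : ℝ} (hm : 0 ≤ m) (hk : 0 ≤ k) (d : ℕ) :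
    (m + k) ^ (d + 1) - m ^ (d + 1) ≤ k * (d + 1) * (m + k) ^ d := by
  induction d with
  | zero => simp
  | succ d ih =>
    have h1 : m ^ (d + 1) ≤ (m + k) ^ (d + 1) := by gcongr; linarith
    have h2 := mul_le_mul_of_nonneg_left ih (add_nonneg hm hk)
    have h3 := mul_le_mul_of_nonneg_left h1 hk
    push_cast
    calc (m + k) ^ (d + 1 + 1) - m ^ (d + 1 + 1)
        = (m + k) * ((m + k) ^ (d + 1) - m ^ (d + 1)) + k * m ^ (d + 1) := by ring
      _ ≤ (m + k) * (k * (d + 1) * (m + k) ^ d) + k * (m + k) ^ (d + 1) := add_le_add h2 h3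
      _ = _ := by ring

/-- A function that grows by at least `c n ^ d` over steps of fixed size grows like `n ^ (d + 1)`. -/
theorem exists_pow_succ_le_of_step {H : ℕ → ℝ} {d k : ℕ} {c : ℝ} (hc : 0 < c) (hk : k ≠ 0)
    (h1 : ∀ n, n ≠ 0 → 1 ≤ H n)
    (hstep : ∀ n, n ≠ 0 → H n + c * ((n + k : ℕ) : ℝ) ^ d ≤ H (n + k)) :
    ∃ c' : ℝ, 0 < c' ∧ ∀ n : ℕ, n ≠ 0 → c' * (n : ℝ) ^ (d + 1) ≤ H n := by
  have hk' : (0 : ℝ) < k := by positivity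
  -- The first term keeps the increment of c' n^(d+1) over a step k below c (n + k)^d; the second
  -- handles the initial range n ≤ k, where only H ≥ 1 is known.
  refine ⟨min (c / (k * (d + 1))) (1 / k ^ (d + 1)), by positivity, fun n => ?_⟩
  set c' := min (c / (k * (d + 1))) (1 / (k : ℝ) ^ (d + 1)) with hc'
  have hc'0 : 0 < c' := by positivity
  have hca : c' * (k * (d + 1)) ≤ c := by
    rw [← le_div_iff₀ (by positivity)]
    exact min_le_left _ _
  have hcb : c' * (k : ℝ) ^ (d + 1) ≤ 1 := by
    rw [← le_div_iff₀ (by positivity)]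
    exact min_le_right _ _
  induction n using Nat.strong_induction_on with
  | _ n ih =>
    intro hn
    rcases le_or_gt n k with hnk | hnk
    · refine le_trans ?_ ((hcb).trans (h1 n hn))
      gcongr
    · obtain ⟨m, rfl⟩ : ∃ m, n = m + k := ⟨n - k, by omega⟩
      have hm : m ≠ 0 := by omega
      refine le_trans ?_ (hstep m hm)
      have h2 := ih m (by omega) hm
      have h3 := pow_succ_sub_pow_succ_le (m.cast_nonneg (α := ℝ)) hk'.le d
      have h4 : c' * (((m : ℝ) + k) ^ (d + 1) - (m : ℝ) ^ (d + 1)) ≤ c * ((m : ℝ) + k) ^ d := by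
        calc _ ≤ c' * (k * (d + 1) * ((m : ℝ) + k) ^ d) := by gcongr
          _ = c' * (k * (d + 1)) * ((m : ℝ) + k) ^ d := by ring
          _ ≤ _ := by gcongr
      push_cast
      linarith

/-- A chain of primes of length n lies entirely above its first member P. -/
theorem exists_isPrime_le_ringKrullDim_quotient {R : Type*} [CommRing R] {n : ℕ}
    (h : n ≤ ringKrullDim R) : ∃ P : Ideal R, P.IsPrime ∧ n ≤ ringKrullDim (R ⧸ P) := by
  obtain ⟨l, hl⟩ := Order.le_krullDim_iff.1 h
  refine ⟨l.head.asIdeal, l.head.isPrime, ?_⟩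
  rw [ringKrullDim_quotient]
  refine Order.le_krullDim_iff.2 ⟨⟨l.length, fun i => ⟨l i, ?_⟩, fun i => l.step i⟩, hl⟩
  exact l.monotone (Fin.zero_le i)

theorem quotLength_pos {R : Type*} [CommRing R] {J : Ideal R} (h : J ≠ ⊤) : 1 ≤ quotLength J := by
  have : Nontrivial (R ⧸ J) := Ideal.Quotient.nontrivial_iff.2 h
  exact Order.one_le_iff_pos.2 Module.length_pos

theorem colength_anti {R : Type*} [CommRing R] {J K : Ideal R} (h : J ≤ K)
    (hJ : quotLength J ≠ ⊤) : colength K ≤ colength J :=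
  ENat.toNat_le_toNat (quotLength_anti h) hJ

theorem quotLength_pow_ne_top {R : Type*} [CommRing R] [IsLocalRing R] [IsNoetherianRing R]
    (n : ℕ) : quotLength (maximalIdeal R ^ n) ≠ ⊤ :=
  quotLength_ne_top_of_pow_le le_rfl

theorem one_le_colength_maximalIdeal_pow {R : Type*} [CommRing R] [IsLocalRing R]
    [IsNoetherianRing R] {n : ℕ} (hn : n ≠ 0) : 1 ≤ colength (maximalIdeal R ^ n) := by
  have h1 := quotLength_pos (J := maximalIdeal R ^ n) fun h =>
    (maximalIdeal.isMaximal R).ne_top (top_le_iff.1 (h ▸ Ideal.pow_le_self hn))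
  exact (ENat.toNat_le_toNat h1 (quotLength_pow_ne_top n) :)

/-- By Artin–Rees, 𝔪^(n+k+1) : x ⊆ 𝔪^n. The colon sequence then bounds the growth of λ(D/𝔪^n) over k
+ 1 steps below by a length over D/(x). -/
theorem exists_pow_succ_le_colength_of_isDomain {D : Type*} [CommRing D] [IsDomain D]
    [IsLocalRing D] [IsNoetherianRing D] {x : D} (hx : x ≠ 0) {d : ℕ} {c : ℝ} (hc : 0 < c)
    (h : ∀ n : ℕ, n ≠ 0 →
      c * (n : ℝ) ^ d ≤ colength (maximalIdeal D ^ n ⊔ Ideal.span {x})) :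
    ∃ c' : ℝ, 0 < c' ∧ ∀ n : ℕ, n ≠ 0 →
      c' * (n : ℝ) ^ (d + 1) ≤ colength (maximalIdeal D ^ n) := by
  obtain ⟨k, hk⟩ := (maximalIdeal D).exists_pow_inf_eq_pow_smul (Ideal.span {x})
  have hcolon (n : ℕ) : (maximalIdeal D ^ (n + (k + 1))).colon {x} ≤ maximalIdeal D ^ n := by
    intro a ha
    have h1 : a * x ∈ (maximalIdeal D ^ (n + (k + 1)) • ⊤ ⊓ Ideal.span {x} : Ideal D) := by
      refine ⟨?_, Ideal.mul_mem_left _ _ (Ideal.mem_span_singleton_self x)⟩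
      simpa using Submodule.mem_colon_singleton.1 ha
    rw [hk _ (by omega), show n + (k + 1) - k = n + 1 by omega] at h1
    have h2 : a * x ∈ maximalIdeal D ^ (n + 1) * Ideal.span {x} :=
      Submodule.smul_mono le_rfl inf_le_right h1
    obtain ⟨z, hz, hzx⟩ := Ideal.mem_mul_span_singleton.1 h2
    rw [mul_right_cancel₀ hx hzx] at hz
    exact Ideal.pow_le_pow_right (Nat.le_succ n) hz
  -- The Artin–Rees constant may be 0, but the step size must not be.
  refine exists_pow_succ_le_of_step (k := k + 1) hc (Nat.succ_ne_zero k)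
    (fun n hn => by exact_mod_cast one_le_colength_maximalIdeal_pow hn) fun n hn => ?_
  have h1 := quotLength_eq_colon_add_sup (maximalIdeal D ^ (n + (k + 1))) x
  have hfin := quotLength_pow_ne_top (R := D) (n + (k + 1))
  have h2 : colength (maximalIdeal D ^ n) +
      colength (maximalIdeal D ^ (n + (k + 1)) ⊔ Ideal.span {x}) ≤
      colength (maximalIdeal D ^ (n + (k + 1))) := by
    have h3 : quotLength (maximalIdeal D ^ n) +
        quotLength (maximalIdeal D ^ (n + (k + 1)) ⊔ Ideal.span {x}) ≤
        quotLength (maximalIdeal D ^ (n + (k + 1))) := by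
      rw [h1]
      gcongr
      exact quotLength_anti (hcolon n)
    have h4 := ENat.toNat_le_toNat h3 hfin
    rwa [ENat.toNat_add (quotLength_pow_ne_top n)
      (quotLength_ne_top_of_pow_le le_sup_left)] at h4
  have h5 := h (n + (k + 1)) (by omega)
  have h6 : (colength (maximalIdeal D ^ n) : ℝ) +
      colength (maximalIdeal D ^ (n + (k + 1)) ⊔ Ideal.span {x}) ≤
      colength (maximalIdeal D ^ (n + (k + 1))) := by exact_mod_cast h2
  linarith

/-- In a Noetherian local ring of dimension at least `d`, the length of `R / 𝔪 ^ n` is bounded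
below by a positive multiple of `n ^ d`. -/
theorem exists_mul_pow_le_colength_maximalIdeal_pow (d : ℕ) {R : Type*} [CommRing R]
    [IsLocalRing R] [IsNoetherianRing R] (hd : d ≤ ringKrullDim R) :
    ∃ c : ℝ, 0 < c ∧ ∀ n : ℕ, n ≠ 0 → c * (n : ℝ) ^ d ≤ colength (maximalIdeal R ^ n) := by
  induction d generalizing R with
  | zero => exact ⟨1, one_pos, fun n hn => by simpa using one_le_colength_maximalIdeal_pow hn⟩
  | succ d ih =>
    -- In the domain R/P any nonzero x in the maximal ideal is a nonzerodivisor, so dividing by it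
    -- lowers the dimension by exactly one.
    obtain ⟨P, hP, hdP⟩ := exists_isPrime_le_ringKrullDim_quotient hd
    have : IsLocalRing (R ⧸ P) :=
      .of_surjective' (Ideal.Quotient.mk P) Ideal.Quotient.mk_surjective
    have hmD := map_maximalIdeal_of_surjective _ (Ideal.Quotient.mk_surjective (I := P))
    suffices ∃ c : ℝ, 0 < c ∧ ∀ n : ℕ, n ≠ 0 →
        c * (n : ℝ) ^ (d + 1) ≤ colength (maximalIdeal (R ⧸ P) ^ n) by
      obtain ⟨c, hc, h⟩ := this
      refine ⟨c, hc, fun n hn => (h n hn).trans ?_⟩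
      have : quotLength (maximalIdeal (R ⧸ P) ^ n) ≤ quotLength (maximalIdeal R ^ n) := by
        rw [← hmD, ← Ideal.map_pow, quotLength_map_mk]
        exact quotLength_anti le_sup_left
      exact_mod_cast ENat.toNat_le_toNat this (quotLength_pow_ne_top n)
    have hdP' : ((d + 1 : ℕ) : WithBot ℕ∞) ≤ krullDimNat (R ⧸ P) := by rwa [coe_krullDimNat]
    have hdP'' : d + 1 ≤ krullDimNat (R ⧸ P) := by exact_mod_cast hdP'
    obtain ⟨x, hx, hx0⟩ : ∃ x ∈ maximalIdeal (R ⧸ P), x ≠ 0 := by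
      refine Submodule.exists_mem_ne_zero_of_ne_bot fun h => ?_
      have h0 := ringKrullDim_eq_zero_of_isField (isField_iff_maximalIdeal_eq.2 h)
      rw [← coe_krullDimNat] at h0
      have : krullDimNat (R ⧸ P) = 0 := by exact_mod_cast h0
      omega
    have hxtop : Ideal.span {x} ≠ ⊤ := fun h =>
      (mem_maximalIdeal _).1 hx (Ideal.span_singleton_eq_top.1 h)
    have : Nontrivial ((R ⧸ P) ⧸ Ideal.span {x}) := Ideal.Quotient.nontrivial_iff.2 hxtop
    have : IsLocalRing ((R ⧸ P) ⧸ Ideal.span {x}) :=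
      .of_surjective' (Ideal.Quotient.mk _) Ideal.Quotient.mk_surjective
    have hdx := ringKrullDim_quotient_span_singleton_succ_eq_ringKrullDim_of_mem_nonZeroDivisors
      (mem_nonZeroDivisors_of_ne_zero hx0) hx
    rw [← coe_krullDimNat, ← coe_krullDimNat] at hdx
    have hdx' : krullDimNat ((R ⧸ P) ⧸ Ideal.span {x}) + 1 = krullDimNat (R ⧸ P) := by
      exact_mod_cast hdx
    obtain ⟨c, hc, hcn⟩ := ih (R := (R ⧸ P) ⧸ Ideal.span {x}) (by
      rw [← coe_krullDimNat]
      exact_mod_cast (by omega : d ≤ krullDimNat ((R ⧸ P) ⧸ Ideal.span {x})))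
    refine exists_pow_succ_le_colength_of_isDomain hx0 hc fun n hn => (hcn n hn).trans_eq ?_
    rw [← map_maximalIdeal_of_surjective _ (Ideal.Quotient.mk_surjective (I := Ideal.span {x})),
      ← Ideal.map_pow]
    exact congrArg (fun l : ℕ∞ => (l.toNat : ℝ)) (quotLength_map_mk _ _)

end lowerBound

/-! ### Convergence for domains -/

section domain

open IsLocalRing

theorem tendsto_zero_of_ratio_tendsto_lt_one {t : ℕ → ℝ} {ρ : ℝ} (ht : ∀ n, 0 < t n) (hρ : ρ < 1)
    (h : Tendsto (fun n => t (n + 1) / t n) atTop (𝓝 ρ)) : Tendsto t atTop (𝓝 0) := by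
  refine (summable_of_ratio_test_tendsto_lt_one hρ (.of_forall fun n => (ht n).ne')
    (h.congr fun n => ?_)).tendsto_atTop_zero
  rw [Real.norm_of_nonneg (ht _).le, Real.norm_of_nonneg (ht _).le]

/-- A sequence bounded away from `0` and `∞` that satisfies a linear recursion of order one up to
a geometrically decreasing error converges. -/
theorem exists_tendsto_of_recursion {t : ℕ → ℝ} {c₁ c₂ a b C p : ℝ} (hc₁ : 0 < c₁)
    (h₁ : ∀ e, c₁ ≤ t e) (h₂ : ∀ e, t e ≤ c₂) (ha : 0 < a) (hp : 1 < p)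
    (h : ∀ e, |a * t (e + 1) - b * t e| ≤ C / p ^ e) : ∃ l, Tendsto t atTop (𝓝 l) := by
  have hpos (e : ℕ) : 0 < t e := hc₁.trans_le (h₁ e)
  have hc₂ : 0 < c₂ := (hpos 0).trans_le (h₂ 0)
  have hC : 0 ≤ C := by simpa using (abs_nonneg _).trans (h 0)
  have hrec (e : ℕ) : |t (e + 1) - b / a * t e| ≤ C / a / p ^ e := by
    have h3 : t (e + 1) - b / a * t e = (a * t (e + 1) - b * t e) / a := by field_simp
    rw [h3, abs_div, abs_of_pos ha, div_right_comm]
    gcongr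
    exact h e
  have hgeom (K : ℝ) : Tendsto (fun e : ℕ => K / p ^ e) atTop (𝓝 0) :=
    tendsto_const_nhds.div_atTop (tendsto_pow_atTop_atTop_of_one_lt hp)
  have hratio : Tendsto (fun e => t (e + 1) / t e) atTop (𝓝 (b / a)) := by
    rw [tendsto_iff_norm_sub_tendsto_zero]
    refine squeeze_zero (fun _ => norm_nonneg _) (fun e => ?_) (hgeom (C / a / c₁))
    have h3 : t (e + 1) / t e - b / a = (t (e + 1) - b / a * t e) / t e := by
      have := (hpos e).ne'
      field_simp
    rw [h3, Real.norm_eq_abs, abs_div, abs_of_pos (hpos e), div_right_comm]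
    exact div_le_div₀ (by positivity) (hrec e) hc₁ (h₁ e)
  -- A limiting ratio below 1 would force t → 0, one above 1 would force 1/t → 0; the two bounds
  -- exclude both.
  have hρ : b / a = 1 := by
    rcases lt_trichotomy (b / a) 1 with hlt | heq | hgt
    · exact absurd (ge_of_tendsto' (tendsto_zero_of_ratio_tendsto_lt_one hpos hlt hratio) h₁)
        hc₁.not_ge
    · exact heq
    · have hinv : Tendsto (fun e => (t (e + 1))⁻¹ / (t e)⁻¹) atTop (𝓝 (b / a)⁻¹) := by
        refine (hratio.inv₀ (by positivity)).congr fun e => ?_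
        rw [inv_div, div_eq_mul_inv, div_eq_mul_inv, inv_inv, mul_comm]
      have h0 := tendsto_zero_of_ratio_tendsto_lt_one (fun e => inv_pos.2 (hpos e))
        (inv_lt_one_of_one_lt₀ hgt) hinv
      exact absurd (ge_of_tendsto' h0 fun e => inv_anti₀ (hpos e) (h₂ e)) (inv_pos.2 hc₂).not_ge
  refine cauchySeq_tendsto_of_complete (cauchySeq_of_le_geometric p⁻¹ (C / a)
    (inv_lt_one_of_one_lt₀ hp) fun e => ?_)
  have := hrec e
  rw [hρ, one_mul] at this
  rwa [dist_comm, Real.dist_eq, inv_pow, ← div_eq_mul_inv]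

theorem coe_colength {R : Type*} [CommRing R] {J : Ideal R} (h : quotLength J ≠ ⊤) :
    (colength J : ℕ∞) = quotLength J := ENat.natCast_toNat h

variable {R : Type*} [CommRing R] [IsLocalRing R] [IsNoetherianRing R] (p : ℕ) [Fact p.Prime]

theorem IsMPrimary.quotLength_bracketPower_ne_top {I : Ideal R} (hI : IsMPrimary I) (e : ℕ) :
    quotLength (_root_.bracketPower I (p ^ e)) ≠ ⊤ :=
  (hI.bracketPower (pow_ne_zero e (Fact.out : p.Prime).ne_zero)).length_ne_top

theorem IsMPrimary.exists_hilbertKunzSeq_le {I : Ideal R} (hI : IsMPrimary I) :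
    ∃ C : ℝ, ∀ e, hilbertKunzSeq p I e ≤ C := by
  obtain ⟨C, hC⟩ := hI.exists_quotLength_bracketPower_le
  refine ⟨C, fun e => ?_⟩
  have hq : p ^ e ≠ 0 := pow_ne_zero e (Fact.out : p.Prime).ne_zero
  have h := hC (p ^ e) hq
  rw [← coe_colength (hI.quotLength_bracketPower_ne_top p e)] at h
  have h' : colength (_root_.bracketPower I (p ^ e)) ≤ C * (p ^ e) ^ krullDimNat R := by
    exact_mod_cast h
  rw [hilbertKunzSeq, div_le_iff₀ (by positivity)]
  exact_mod_cast h'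

/-- Follows from I^[q] ⊆ I^q ⊆ 𝔪^q and the lower bound for ordinary powers. -/
theorem IsMPrimary.exists_le_hilbertKunzSeq {I : Ideal R} (hI : IsMPrimary I) :
    ∃ c : ℝ, 0 < c ∧ ∀ e, c ≤ hilbertKunzSeq p I e := by
  obtain ⟨c, hc, h⟩ := exists_mul_pow_le_colength_maximalIdeal_pow (krullDimNat R) (R := R)
    (coe_krullDimNat R).le
  refine ⟨c, hc, fun e => ?_⟩
  have hq : p ^ e ≠ 0 := pow_ne_zero e (Fact.out : p.Prime).ne_zero
  rw [hilbertKunzSeq, le_div_iff₀ (by positivity)]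
  refine (h _ hq).trans ?_
  exact_mod_cast colength_anti
    ((bracketPower_le_pow I _).trans (Ideal.pow_right_mono hI.le_maximalIdeal _))
    (hI.quotLength_bracketPower_ne_top p e)

/-- The contribution of a nonzerodivisor `u` to lengths is negligible in the limit. -/
theorem IsMPrimary.exists_colength_sup_span_div_le {I : Ideal R} (hI : IsMPrimary I) {u : R}
    (hu : u ∈ nonZeroDivisors R) :
    ∃ C : ℝ, ∀ e : ℕ, (colength (_root_.bracketPower I (p ^ e) ⊔ Ideal.span {u}) : ℝ) /
      ((p ^ e : ℕ) : ℝ) ^ krullDimNat R ≤ C / (p : ℝ) ^ e := by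
  obtain ⟨C, hC⟩ := hI.exists_mul_quotLength_bracketPower_sup_le hu
  refine ⟨C, fun e => ?_⟩
  have hp : 0 < p := (Fact.out : p.Prime).pos
  have hq : p ^ e ≠ 0 := pow_ne_zero e hp.ne'
  have h := hC (p ^ e) hq
  rw [← coe_colength ((hI.bracketPower hq).quotLength_sup_ne_top _)] at h
  have h' : p ^ e * colength (_root_.bracketPower I (p ^ e) ⊔ Ideal.span {u}) ≤
      C * (p ^ e) ^ krullDimNat R := by exact_mod_cast h
  rw [div_le_div_iff₀ (by positivity) (by positivity), mul_comm]
  exact_mod_cast h'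

variable [CharP R p]

theorem IsMPrimary.exists_tendsto_hilbertKunzSeq_of_isDomain [IsDomain R] (hF : IsFFinite R p)
    {I : Ideal R} (hI : IsMPrimary I) : ∃ l, Tendsto (hilbertKunzSeq p I) atTop (𝓝 l) := by
  have hp : p.Prime := Fact.out
  have : IsLocalHom (frobenius R p) := ⟨fun a ha => (isUnit_pow_iff hp.ne_zero).1 ha⟩
  obtain ⟨r, α, n, u, hα, hu, h⟩ := exists_quotLength_map_compare (frobenius R p) hF
  obtain ⟨c₁, hc₁, h₁⟩ := hI.exists_le_hilbertKunzSeq p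
  obtain ⟨c₂, h₂⟩ := hI.exists_hilbertKunzSeq_le p
  obtain ⟨C, hC⟩ := hI.exists_colength_sup_span_div_le p (mem_nonZeroDivisors_of_ne_zero hu)
  have hp0 : (0 : ℝ) < p := by exact_mod_cast hp.pos
  -- The factor p^d in a compensates for normalizing the term e + 1 by (p^(e+1))^d.
  refine exists_tendsto_of_recursion (a := α * (p : ℝ) ^ krullDimNat R) (b := r) (C := n * C)
    (p := p) hc₁ h₁ h₂ (by positivity) (by exact_mod_cast hp.one_lt) fun e => ?_
  obtain ⟨ha, hb⟩ := h (_root_.bracketPower I (p ^ e))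
  rw [← bracketPower_succ, ← coe_colength (hI.quotLength_bracketPower_ne_top p e),
    ← coe_colength (hI.quotLength_bracketPower_ne_top p (e + 1)), ← coe_colength
    ((hI.bracketPower (pow_ne_zero e hp.ne_zero)).quotLength_sup_ne_top (Ideal.span {u}))] at ha hb
  set s := colength (_root_.bracketPower I (p ^ e)) with hs
  set s' := colength (_root_.bracketPower I (p ^ (e + 1))) with hs'
  set w := colength (_root_.bracketPower I (p ^ e) ⊔ Ideal.span {u}) with hw
  have ha' : (α : ℝ) * s' ≤ r * s + n * w := by exact_mod_cast ha
  have hb' : (r : ℝ) * s ≤ α * s' + n * w := by exact_mod_cast hb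
  have heq : α * (p : ℝ) ^ krullDimNat R * hilbertKunzSeq p I (e + 1) -
      r * hilbertKunzSeq p I e = (α * s' - r * s) / ((p ^ e : ℕ) : ℝ) ^ krullDimNat R := by
    simp only [hilbertKunzSeq, ← hs, ← hs']
    push_cast
    rw [pow_succ (p : ℝ), mul_pow]
    field_simp
  rw [heq, abs_div, abs_of_pos (a := ((p ^ e : ℕ) : ℝ) ^ krullDimNat R)
    (by have := hp.pos; positivity)]
  calc |(α : ℝ) * s' - r * s| / ((p ^ e : ℕ) : ℝ) ^ krullDimNat R
      ≤ n * w / ((p ^ e : ℕ) : ℝ) ^ krullDimNat R := by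
        gcongr
        rw [abs_le]
        constructor <;> linarith
    _ = n * (w / ((p ^ e : ℕ) : ℝ) ^ krullDimNat R) := by ring
    _ ≤ n * (C / p ^ e) := mul_le_mul_of_nonneg_left (hC e) (by positivity)
    _ = _ := by ring

end domain

/-! ### From domains to reduced rings -/

section reduced

open IsLocalRing

/-- A reduced Noetherian ring `R` and the product of its quotients by minimal primes map to each
other with cokernels killed by a nonzerodivisor. -/
theorem exists_linearMap_pi_minimalPrimes (R : Type*) [CommRing R] [IsNoetherianRing R]
    [IsReduced R] :
    ∃ (f : R →ₗ[R] ∀ P : minimalPrimes R, R ⧸ P.1)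
      (g : (∀ P : minimalPrimes R, R ⧸ P.1) →ₗ[R] R) (u : R), u ∈ nonZeroDivisors R ∧
      (∀ y, u • y ∈ LinearMap.range f) ∧ ∀ y : R, u • y ∈ LinearMap.range g := by
  classical
  have := (minimalPrimes.finite_of_isNoetherianRing R).to_subtype
  have := Fintype.ofFinite (minimalPrimes R)
  have hprime (P : minimalPrimes R) : P.1.IsPrime := P.2.1.1
  have hzero (x : R) (hx : ∀ P : minimalPrimes R, x ∈ P.1) : x = 0 := by
    have h1 : x ∈ sInf (minimalPrimes R) := by
      rw [Submodule.mem_sInf]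
      exact fun P hP => hx ⟨P, hP⟩
    rw [minimalPrimes, Ideal.sInf_minimalPrimes] at h1
    obtain ⟨n, hn⟩ := h1
    exact eq_zero_of_pow_eq_zero hn
  -- Otherwise P contains the intersection of the other minimal primes, hence one of them, against
  -- minimality.
  have hex (P : minimalPrimes R) : ∃ v, v ∉ P.1 ∧ ∀ Q : minimalPrimes R, Q ≠ P → v ∈ Q.1 := by
    by_contra! hcon
    have hle : (Finset.univ.erase P).inf (fun Q : minimalPrimes R => Q.1) ≤ P.1 := by
      intro v hv
      by_contra hvP
      obtain ⟨Q, hQP, hvQ⟩ := hcon v hvP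
      exact hvQ ((Submodule.mem_finsetInf.1 hv) Q (by simp [hQP]))
    obtain ⟨Q, hQ, hQP⟩ := (hprime P).inf_le'.1 hle
    exact (Finset.mem_erase.1 hQ).1
      (Subtype.ext (le_antisymm hQP (P.2.2 Q.2.1 hQP)))
  choose v hv hvQ using hex
  have hsum (P : minimalPrimes R) (w : minimalPrimes R → R) :
      (Ideal.Quotient.mk P.1) (∑ Q, v Q * w Q) = Ideal.Quotient.mk P.1 (v P * w P) := by
    rw [map_sum, Finset.sum_eq_single P]
    · intro Q _ hQP
      exact Ideal.Quotient.eq_zero_iff_mem.2 (Ideal.mul_mem_right _ _ (hvQ Q P hQP.symm))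
    · simp
  have hker (P : minimalPrimes R) : P.1 ≤ LinearMap.ker (LinearMap.mulLeft R (v P)) := by
    intro x hx
    rw [LinearMap.mem_ker, LinearMap.mulLeft_apply]
    refine hzero _ fun Q => ?_
    by_cases hQP : Q = P
    · exact hQP.symm ▸ Ideal.mul_mem_left _ _ hx
    · exact Ideal.mul_mem_right _ _ (hvQ P Q hQP)
  -- On R/P the map g is multiplication by v_P, well defined since v_P P lies in every minimal prime
  -- and R is reduced. With u = ∑ v_P, both composites of f and g are multiplication by u, as u ≡
  -- v_P mod P.
  refine ⟨LinearMap.pi fun P => P.1.mkQ,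
    LinearMap.lsum R (fun P : minimalPrimes R => R ⧸ P.1) ℕ fun P => Submodule.liftQ _ _ (hker P),
    ∑ P, v P, ?_, fun y => ?_, fun y => ?_⟩
  · refine mem_nonZeroDivisors_iff_right.2 fun x hx => hzero x fun P => ?_
    have h1 : (∑ Q, v Q) ∉ P.1 := by
      rw [← Ideal.Quotient.eq_zero_iff_mem]
      have := hsum P fun _ => 1
      simp only [mul_one] at this
      rw [this, Ideal.Quotient.eq_zero_iff_mem]
      exact hv P
    exact ((hprime P).mem_or_mem (hx ▸ P.1.zero_mem : x * ∑ Q, v Q ∈ P.1)).resolve_right h1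
  · choose a ha using fun P => Ideal.Quotient.mk_surjective (y P)
    refine ⟨∑ Q, v Q * a Q, funext fun P => ?_⟩
    have h1 := hsum P fun _ => a P
    rw [← Finset.sum_mul] at h1
    calc _ = Ideal.Quotient.mk P.1 (∑ Q, v Q * a Q) := rfl
      _ = Ideal.Quotient.mk P.1 ((∑ Q, v Q) * a P) := by rw [hsum, h1]
      _ = (∑ Q, v Q) • y P := by rw [← ha P]; rfl
  · refine ⟨fun P => Submodule.Quotient.mk y, ?_⟩
    simp only [LinearMap.lsum_apply, LinearMap.coe_sum, LinearMap.coe_comp, Finset.sum_apply,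
      Function.comp_apply, LinearMap.proj_apply, Submodule.liftQ_apply, LinearMap.mulLeft_apply,
      smul_eq_mul, Finset.sum_mul]

variable {R : Type*} [CommRing R]

theorem IsFFinite.quotient {p : ℕ} [Fact p.Prime] [CharP R p] (hF : IsFFinite R p) (P : Ideal R)
    [CharP (R ⧸ P) p] : IsFFinite (R ⧸ P) p := by
  have h : (frobenius (R ⧸ P) p).comp (Ideal.Quotient.mk P) =
      (Ideal.Quotient.mk P).comp (frobenius R p) :=
    (RingHom.frobenius_comm _ _).symm
  refine RingHom.Finite.of_comp_finite (f := Ideal.Quotient.mk P) ?_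
  rw [h]
  exact (RingHom.Finite.of_surjective _ Ideal.Quotient.mk_surjective).comp hF

theorem charP_quotient_of_ne_top {p : ℕ} [Fact p.Prime] [CharP R p] {P : Ideal R} (hP : P ≠ ⊤) :
    CharP (R ⧸ P) p := by
  have : Nontrivial (R ⧸ P) := Ideal.Quotient.nontrivial_iff.2 hP
  rw [CharP.charP_iff_prime_eq_zero Fact.out, ← map_natCast (Ideal.Quotient.mk P),
    CharP.cast_eq_zero, map_zero]

variable [IsLocalRing R] [IsNoetherianRing R] (p : ℕ) [Fact p.Prime] [CharP R p]

/-- The lengths of `(R / P) / I^[q] (R / P)`, normalized by `q ^ dim R`, converge. -/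
theorem IsMPrimary.exists_tendsto_colength_sup_prime (hF : IsFFinite R p) {I : Ideal R}
    (hI : IsMPrimary I) (P : Ideal R) [P.IsPrime] :
    ∃ l : ℝ, Tendsto (fun e : ℕ => (colength (_root_.bracketPower I (p ^ e) ⊔ P) : ℝ) /
      ((p ^ e : ℕ) : ℝ) ^ krullDimNat R) atTop (𝓝 l) := by
  have hp : p.Prime := Fact.out
  have : CharP (R ⧸ P) p := charP_quotient_of_ne_top (Ideal.IsPrime.ne_top ‹_›)
  have : IsLocalRing (R ⧸ P) :=
    .of_surjective' (Ideal.Quotient.mk P) Ideal.Quotient.mk_surjective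
  obtain ⟨l, hl⟩ := (hI.map_of_surjective (Ideal.Quotient.mk P)
    Ideal.Quotient.mk_surjective).exists_tendsto_hilbertKunzSeq_of_isDomain p (hF.quotient P)
  have hdim : krullDimNat (R ⧸ P) ≤ krullDimNat R := by
    have h := ringKrullDim_quotient_le P
    rw [← coe_krullDimNat, ← coe_krullDimNat] at h
    exact_mod_cast h
  obtain ⟨k, hk⟩ := Nat.exists_eq_add_of_le hdim
  have hlen (e : ℕ) : colength (_root_.bracketPower I (p ^ e) ⊔ P) =
      colength (_root_.bracketPower (I.map (Ideal.Quotient.mk P)) (p ^ e)) := by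
    rw [bracketPower_map]
    exact congrArg ENat.toNat (quotLength_map_mk _ _).symm
  -- Here k = dim R − dim R/P; components of smaller dimension contribute 0 to the limit.
  have hkt : ∃ l' : ℝ, Tendsto (fun e : ℕ => ((((p : ℝ)⁻¹) ^ k) ^ e)) atTop (𝓝 l') := by
    have hp1 : (1 : ℝ) < p := by exact_mod_cast hp.one_lt
    rcases eq_or_ne k 0 with rfl | hk0
    · exact ⟨1, by simp⟩
    · exact ⟨0, tendsto_pow_atTop_nhds_zero_of_lt_one (by positivity)
        (pow_lt_one₀ (by positivity) (inv_lt_one_of_one_lt₀ hp1) hk0)⟩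
  obtain ⟨l', hl'⟩ := hkt
  refine ⟨l * l', (hl.mul hl').congr fun e => ?_⟩
  have hp0 : (p : ℝ) ≠ 0 := by exact_mod_cast hp.ne_zero
  rw [hilbertKunzSeq, ← hlen, hk, pow_add, ← pow_mul, inv_pow]
  push_cast
  rw [mul_comm k e, pow_mul]
  field_simp

theorem IsMPrimary.exists_tendsto_hilbertKunzSeq [IsReduced R] (hF : IsFFinite R p) {I : Ideal R}
    (hI : IsMPrimary I) : ∃ l, Tendsto (hilbertKunzSeq p I) atTop (𝓝 l) := by
  have hp : p.Prime := Fact.out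
  have := (minimalPrimes.finite_of_isNoetherianRing R).to_subtype
  have := Fintype.ofFinite (minimalPrimes R)
  have hprime (P : minimalPrimes R) : P.1.IsPrime := P.2.1.1
  obtain ⟨f, g, u, hu, hf, hg⟩ := exists_linearMap_pi_minimalPrimes R
  obtain ⟨n₁, hn₁⟩ := Module.exists_length_tensor_le f u hf
  obtain ⟨n₂, hn₂⟩ := Module.exists_length_tensor_le g u hg
  simp only [Module.length_quotient_tensor_self, Module.length_quotient_tensor_pi,
    Module.length_quotient_tensor_quotient] at hn₁ hn₂
  choose l hl using fun P : minimalPrimes R => hI.exists_tendsto_colength_sup_prime p hF P.1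
  have hsum := tendsto_finsetSum Finset.univ fun P _ => hl P
  obtain ⟨C, hC⟩ := hI.exists_colength_sup_span_div_le p hu
  have hp1 : (1 : ℝ) < p := by exact_mod_cast hp.one_lt
  have hgeom (n : ℕ) : Tendsto (fun e : ℕ => n * (C / (p : ℝ) ^ e)) atTop (𝓝 0) := by
    simpa using (tendsto_const_nhds (x := C)).div_atTop
      (tendsto_pow_atTop_atTop_of_one_lt hp1) |>.const_mul (n : ℝ)
  have key (e : ℕ) : ∑ P : minimalPrimes R,
        (colength (_root_.bracketPower I (p ^ e) ⊔ P.1) : ℝ) /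
          ((p ^ e : ℕ) : ℝ) ^ krullDimNat R ≤ hilbertKunzSeq p I e + n₁ * (C / p ^ e) ∧
      hilbertKunzSeq p I e ≤ ∑ P : minimalPrimes R,
        (colength (_root_.bracketPower I (p ^ e) ⊔ P.1) : ℝ) /
          ((p ^ e : ℕ) : ℝ) ^ krullDimNat R + n₂ * (C / p ^ e) := by
    have hfin (J : Ideal R) := coe_colength
      ((hI.bracketPower (pow_ne_zero e hp.ne_zero)).quotLength_sup_ne_top J)
    have h1 := hn₁ (_root_.bracketPower I (p ^ e))
    have h2 := hn₂ (_root_.bracketPower I (p ^ e))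
    simp only [← hfin, ← coe_colength (hI.quotLength_bracketPower_ne_top p e)] at h1 h2
    have h1' : ∑ P : minimalPrimes R, (colength (_root_.bracketPower I (p ^ e) ⊔ P.1) : ℝ) ≤
        colength (_root_.bracketPower I (p ^ e)) +
          n₁ * colength (_root_.bracketPower I (p ^ e) ⊔ Ideal.span {u}) := by exact_mod_cast h1
    have h2' : (colength (_root_.bracketPower I (p ^ e)) : ℝ) ≤
        ∑ P : minimalPrimes R, (colength (_root_.bracketPower I (p ^ e) ⊔ P.1) : ℝ) +
          n₂ * colength (_root_.bracketPower I (p ^ e) ⊔ Ideal.span {u}) := by exact_mod_cast h2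
    have hq : (0 : ℝ) ≤ ((p ^ e : ℕ) : ℝ) ^ krullDimNat R := by positivity
    rw [← Finset.sum_div, hilbertKunzSeq]
    constructor
    · refine (div_le_div_of_nonneg_right h1' hq).trans ?_
      rw [add_div, mul_div_assoc]
      exact add_le_add_right (mul_le_mul_of_nonneg_left (hC e) (by positivity)) _
    · refine (div_le_div_of_nonneg_right h2' hq).trans ?_
      rw [add_div, mul_div_assoc]
      exact add_le_add_right (mul_le_mul_of_nonneg_left (hC e) (by positivity)) _
  refine ⟨_, tendsto_of_tendsto_of_tendsto_of_le_of_le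
    (by simpa using hsum.sub (hgeom n₁)) (by simpa using hsum.add (hgeom n₂))
    (fun e => ?_) fun e => (key e).2⟩
  simpa using (key e).1

end reduced

/-! ### The inequality at each level q -/

section inequality

open IsLocalRing

variable {R : Type*} [CommRing R] [IsLocalRing R]

/-- With k + 1 the least exponent such that 𝔪^(k+1) ⊆ I, any x in 𝔪^k outside I represents a socle
element of R/I. -/
theorem exists_colon_singleton_eq_maximalIdeal {I : Ideal R} (hI : ∃ k, maximalIdeal R ^ k ≤ I)
    (htop : I ≠ ⊤) : ∃ x, I.colon {x} = maximalIdeal R := by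
  classical
  have hk := Nat.find_spec hI
  have hk0 : Nat.find hI ≠ 0 := fun h => htop (by simpa [h] using hk)
  obtain ⟨k, hkk⟩ := Nat.exists_eq_succ_of_ne_zero hk0
  obtain ⟨x, hx, hxI⟩ := SetLike.not_le_iff_exists.1 (Nat.find_min hI (m := k) (by omega))
  refine ⟨x, (((maximalIdeal.isMaximal R).eq_of_le (fun h => hxI ?_) fun a ha => ?_)).symm⟩
  · have h1 : (1 : R) ∈ I.colon {x} := h ▸ trivial
    simpa using Submodule.mem_colon_singleton.1 h1
  · refine Submodule.mem_colon_singleton.2 (hk ?_)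
    rw [hkk, pow_succ']
    exact Ideal.mul_mem_mul ha hx

/-- Filtering `R / I` with quotients `R / 𝔪` bounds the length of `R / I^[q]`. -/
theorem quotLength_bracketPower_le_mul (p : ℕ) [ExpChar R p] {I : Ideal R}
    (hI : ∃ k, maximalIdeal R ^ k ≤ I) {n : ℕ} (hn : quotLength I = n) (e : ℕ) :
    quotLength (bracketPower I (p ^ e)) ≤
      quotLength (bracketPower (maximalIdeal R) (p ^ e)) * n := by
  -- Requiring only 𝔪^k ⊆ I admits I = R, where the induction ends.
  induction n generalizing I with
  | zero =>
    have hItop : I = ⊤ := by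
      by_contra h
      have := quotLength_pos h
      simp [hn] at this
    have h1 : bracketPower I (p ^ e) = ⊤ := by
      rw [bracketPower_eq_map_iterateFrobenius, hItop, Ideal.map_top]
    simp [h1]
  | succ n ih =>
    have hItop : I ≠ ⊤ := by
      rintro rfl
      rw [quotLength_top] at hn
      exact absurd hn (by exact_mod_cast (Nat.succ_ne_zero n).symm)
    obtain ⟨x, hx⟩ := exists_colon_singleton_eq_maximalIdeal hI hItop
    have hcolon := quotLength_eq_colon_add_sup I x
    have hone : quotLength (maximalIdeal R) = 1 := by
      have : IsSimpleModule R (R ⧸ maximalIdeal R) := by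
        exact isSimpleModule_iff_isCoatom.2 (maximalIdeal.isMaximal R).out
      exact Module.length_eq_one R _
    rw [hx, hone, hn, Nat.cast_succ, add_comm] at hcolon
    have hsup : quotLength (I ⊔ Ideal.span {x}) = n :=
      (WithTop.add_left_cancel ENat.one_ne_top hcolon).symm
    -- Additivity of Frobenius identifies I^[q] + (x^q) with (I + (x))^[q]. The colon term is
    -- bounded because ax ∈ I gives a^q x^q ∈ I^[q].
    rw [quotLength_eq_colon_add_sup _ (x ^ p ^ e), Nat.cast_succ, mul_add, mul_one, add_comm,
      ← bracketPower_sup_span_singleton]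
    refine add_le_add (ih (hI.imp fun _ h => h.trans le_sup_left) hsup)
      (quotLength_anti (Ideal.span_le.2 ?_))
    rintro _ ⟨a, ha, rfl⟩
    rw [← hx] at ha
    refine Submodule.mem_colon_singleton.2 ?_
    rw [smul_eq_mul, ← mul_pow]
    exact pow_mem_bracketPower (Submodule.mem_colon_singleton.1 ha) _

end inequality
end

theorem proposition4p3 {R : Type*} [CommRing R] [IsLocalRing R] [IsNoetherianRing R]
    [IsReduced R] (p : ℕ) [Fact p.Prime] [CharP R p] (hF : IsFFinite R p)
    (I : Ideal R) (hI : IsMPrimary I) :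
    Tendsto (hilbertKunzSeq p I) atTop (𝓝 (hilbertKunzMultiplicity p I)) ∧
    Tendsto (hilbertKunzSeq p (IsLocalRing.maximalIdeal R)) atTop
      (𝓝 (ringHilbertKunzMultiplicity R p)) ∧
    hilbertKunzMultiplicity p I ≤ ringHilbertKunzMultiplicity R p * (colength I : ℝ) := by
  have hm := isMPrimary_maximalIdeal (R := R)
  have h1 : Tendsto (hilbertKunzSeq p I) atTop (𝓝 (hilbertKunzMultiplicity p I)) :=
    tendsto_nhds_limUnder (hI.exists_tendsto_hilbertKunzSeq p hF)
  have h2 : Tendsto (hilbertKunzSeq p (IsLocalRing.maximalIdeal R)) atTop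
      (𝓝 (ringHilbertKunzMultiplicity R p)) :=
    tendsto_nhds_limUnder (hm.exists_tendsto_hilbertKunzSeq p hF)
  refine ⟨h1, h2, le_of_tendsto_of_tendsto' h1 (h2.mul_const _) fun e => ?_⟩
  have h := quotLength_bracketPower_le_mul p hI.exists_pow_le (coe_colength hI.length_ne_top).symm e
  rw [← coe_colength (hI.quotLength_bracketPower_ne_top p e),
    ← coe_colength (hm.quotLength_bracketPower_ne_top p e)] at h
  rw [hilbertKunzSeq, hilbertKunzSeq, div_mul_eq_mul_div]
  gcongr
  exact_mod_cast h
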